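/- Let $A$ be a separable $C^*$-algebra (not necessarily unital) and let $J$ be a real antisymmetric $n\times n$ matrix. Let $S^A(\mathbb R^n)$ be the space of $A$-valued Schwartz functions on $\mathbb R^n$ with the $A$-valued inner product $\langle f,g\rangle=\int f(x)^*g(x)\,dx$ and the norm $\|f\|_2=\|\langle f,f\rangle\|^{1/2}$, and let $E=\overline{S^A(\mathbb R^n)}$ be its completion, with the continuously extended inner product. For $f,g\in S^A(\mathbb R^n)$ let $$(f\times_J g)(x)=(2\pi)^{-n}\iint f(x+Ju)\,g(x+v)\,e^{iu\cdot v}\,du\,dv$$ (an oscillatory integral) be the deformed product, and let $R_g$ be the bounded operator on $E$ that extends $f\mapsto f\times_J g$. For $z,\zeta\in\mathbb R^n$ let $E_{z,\zeta}$ be the unitary operator on $E$ that extends $(E_{z,\zeta}f)(x)=e^{i\zeta\cdot x}f(x-z)$, and for a bounded operator $T$ on $E$ put $T_{z,\zeta}=E_{z,\zeta}^{-1}TE_{z,\zeta}$. Call $T$ smooth under translations if $z\mapsto T_{z,0}$ is $C^\infty$ on $\mathbb R^n$, and Heisenberg-smooth if $(z,\zeta)\mapsto T_{z,\zeta}$ is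 $C^\infty$ on $\mathbb R^{2n}$, both with respect to the operator norm. Let $T$ be a bounded linear operator on $E$ that has an adjoint with respect to $\langle\cdot,\cdot\rangle$ and satisfies $TR_g=R_gT$ for every $g\in S^A(\mathbb R^n)$. Then $$T_{z,\zeta}=T_{z-J\zeta,\,0}\qquad\text{for all }z,\zeta\in\mathbb R^n,$$ and if $T$ is smooth under translations, then $T$ is Heisenberg-smooth. -/

import Mathlib

open MeasureTheory
open scoped SchwartzMap ContDiff

namespace Rieffel

section Schwartz

variable {n : ℕ} {A : Type*} [NonUnitalCStarAlgebra A]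

/-- Euclidean space `ℝⁿ`. -/
abbrev V (n : ℕ) : Type := EuclideanSpace ℝ (Fin n)


/-- `phase u x = e^{i u·x}`. -/
noncomputable def phase (u x : V n) : ℂ := Complex.exp (Complex.I * (inner ℝ u x : ℝ))

theorem norm_phase (u x : V n) : ‖phase u x‖ = 1 := by
  rw [phase, mul_comm, Complex.norm_exp_ofReal_mul_I]

theorem continuous_phase : Continuous fun p : V n × V n => phase p.1 p.2 := by
  unfold phase; fun_prop

/-- `∫ e^{-i u·x} f(x + L u) G(u) du`; the partially evaluated form of the deformed product, used to
show that it is a Schwartz function. -/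
noncomputable def twist (L : V n →L[ℝ] V n) (f G : 𝓢(V n, A)) (x : V n) : A :=
  ∫ u, phase (-u) x • (f (x + L u) * G u)

theorem integrable_twist (L : V n →L[ℝ] V n) (f G : 𝓢(V n, A)) (x : V n) :
    Integrable fun u => phase (-u) x • (f (x + L u) * G u) := by
  refine (G.integrable (μ := volume)).norm.const_mul (SchwartzMap.seminorm ℝ 0 0 f) |>.mono' ?_ ?_
  · refine Continuous.aestronglyMeasurable ?_
    have := f.continuous
    have := G.continuous
    have : Continuous fun u : V n => phase (-u) x :=
      continuous_phase.comp (by fun_prop : Continuous fun u : V n => (-u, x))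
    fun_prop
  · refine Filter.Eventually.of_forall fun u => ?_
    rw [norm_smul, norm_phase, one_mul]
    refine (norm_mul_le _ _).trans ?_
    gcongr
    exact f.norm_le_seminorm ℝ _

/-- `u ↦ -i ⟨u, e⟩ G u`. -/
noncomputable def momentum (e : V n) (G : 𝓢(V n, A)) : 𝓢(V n, A) :=
  (-Complex.I) • SchwartzMap.smulLeftCLM A (fun u : V n => (inner ℝ u e : ℝ)) G

theorem momentum_apply (e : V n) (G : 𝓢(V n, A)) (u : V n) :
    momentum e G u = (-Complex.I * (inner ℝ u e : ℝ)) • G u := by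
  have h : (fun u : V n => (inner ℝ u e : ℝ)).HasTemperateGrowth := by fun_prop
  rw [momentum, smul_apply, SchwartzMap.smulLeftCLM_apply_apply h, mul_smul]
  simp

open scoped LineDeriv in
/-- The directional derivative of a Schwartz function. -/
noncomputable def dirDeriv (e : V n) (f : 𝓢(V n, A)) : 𝓢(V n, A) := ∂_{e} f

theorem dirDeriv_apply (e : V n) (f : 𝓢(V n, A)) (x : V n) :
    dirDeriv e f x = fderiv ℝ f x e := by
  rw [dirDeriv, SchwartzMap.lineDerivOp_apply_eq_fderiv]

/-- The derivative in `x` of the integrand of `twist`. -/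
noncomputable def dTwist (L : V n →L[ℝ] V n) (f G : 𝓢(V n, A)) (x u : V n) : V n →L[ℝ] A :=
  phase (-u) x • (((ContinuousLinearMap.mul ℝ A).flip (G u)).comp (fderiv ℝ f (x + L u))) +
    (innerSL ℝ u).smulRight ((-Complex.I * phase (-u) x) • (f (x + L u) * G u))

theorem hasFDerivAt_integrand (L : V n →L[ℝ] V n) (f G : 𝓢(V n, A)) (x u : V n) :
    HasFDerivAt (fun x => phase (-u) x • (f (x + L u) * G u)) (dTwist L f G x u) x := by
  have h1 : HasFDerivAt (fun x => phase (-u) x)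
      ((innerSL ℝ u).smulRight (-Complex.I * phase (-u) x)) x := by
    have h0 : HasFDerivAt (fun x : V n => Complex.I * (inner ℝ (-u) x : ℝ))
        ((innerSL ℝ u).smulRight (-Complex.I)) x := by
      have : (fun x : V n => Complex.I * (inner ℝ (-u) x : ℝ)) =
          ((innerSL ℝ u).smulRight (-Complex.I)) := by
        ext x; simp [mul_comm]
      rw [this]
      exact ContinuousLinearMap.hasFDerivAt _
    exact HasFDerivAt.congr_fderiv (f := fun x => phase (-u) x) h0.cexp (by
      ext v
      simp [phase]
      ring)
  have h2 : HasFDerivAt (fun x => f (x + L u) * G u)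
      (((ContinuousLinearMap.mul ℝ A).flip (G u)).comp (fderiv ℝ f (x + L u))) x := by
    have := (f.differentiable (x := x + L u)).hasFDerivAt.comp x
      ((hasFDerivAt_id x).add_const (L u))
    exact ((ContinuousLinearMap.mul ℝ A).flip (G u)).hasFDerivAt.comp x this
  exact HasFDerivAt.congr_fderiv (f := fun x => phase (-u) x • (f (x + L u) * G u))
    (h1.smul h2) (by
      ext v
      simp only [dTwist, add_apply, smul_apply, ContinuousLinearMap.smulRight_apply]
      rw [smul_assoc])

theorem norm_dTwist_le (L : V n →L[ℝ] V n) (f G : 𝓢(V n, A)) (x u : V n) :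
    ‖dTwist L f G x u‖ ≤ SchwartzMap.seminorm ℝ 0 1 f * ‖G u‖ +
      SchwartzMap.seminorm ℝ 0 0 f * (‖u‖ ^ 1 * ‖G u‖) := by
  refine (norm_add_le _ _).trans (add_le_add ?_ ?_)
  · rw [norm_smul, norm_phase, one_mul]
    refine (ContinuousLinearMap.opNorm_comp_le _ _).trans ?_
    rw [mul_comm]
    gcongr
    · have := f.norm_iteratedFDeriv_le_seminorm ℝ 1 (x + L u)
      rwa [← norm_fderiv_iteratedFDeriv (n := 0), norm_fderiv_iteratedFDeriv,
        norm_iteratedFDeriv_one] at this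
    · refine ContinuousLinearMap.opNorm_le_bound _ (norm_nonneg _) fun a => ?_
      simpa [mul_comm] using norm_mul_le a (G u)
  · rw [ContinuousLinearMap.norm_smulRight_apply, innerSL_apply_norm, norm_smul, norm_mul, norm_neg,
      Complex.norm_I, norm_phase, one_mul, one_mul, pow_one]
    have := (norm_mul_le (f (x + L u)) (G u)).trans
      (mul_le_mul_of_nonneg_right (f.norm_le_seminorm ℝ (x + L u)) (norm_nonneg _))
    calc _ ≤ ‖u‖ * (SchwartzMap.seminorm ℝ 0 0 f * ‖G u‖) := by gcongr
      _ = _ := by ring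

theorem continuous_dTwist (L : V n →L[ℝ] V n) (f G : 𝓢(V n, A)) (x : V n) :
    Continuous (dTwist L f G x) := by
  have h1 := f.continuous
  have h2 := G.continuous
  have h3 : Continuous (fderiv ℝ f) := (f.smooth 1).continuous_fderiv (by simp)
  have h4 : Continuous fun u : V n => phase (-u) x :=
      continuous_phase.comp (by fun_prop : Continuous fun u : V n => (-u, x))
  unfold dTwist
  refine Continuous.add ?_ ?_
  · refine h4.smul (Continuous.clm_comp ?_ ?_)
    · exact (ContinuousLinearMap.continuous _).comp h2
    · exact h3.comp (by fun_prop)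
  · exact ((ContinuousLinearMap.smulRightL ℝ (V n) A).continuous.comp
      (innerSL ℝ).continuous).clm_apply (by fun_prop)

theorem hasFDerivAt_twist (L : V n →L[ℝ] V n) (f G : 𝓢(V n, A)) (x : V n) :
    Integrable (dTwist L f G x) ∧
    HasFDerivAt (twist L f G) (∫ u, dTwist L f G x u) x := by
  have hb : Integrable fun u : V n => SchwartzMap.seminorm ℝ 0 1 f * ‖G u‖ +
      SchwartzMap.seminorm ℝ 0 0 f * (‖u‖ ^ 1 * ‖G u‖) :=
    (G.integrable.norm.const_mul _).add ((G.integrable_pow_mul volume 1).const_mul _)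
  refine ⟨hb.mono' (continuous_dTwist L f G x).aestronglyMeasurable
    (Filter.Eventually.of_forall fun u => norm_dTwist_le L f G x u), ?_⟩
  refine hasFDerivAt_integral_of_dominated_of_fderiv_le (𝕜 := ℝ) (s := Set.univ)
    Filter.univ_mem
    (Filter.Eventually.of_forall fun x => (integrable_twist L f G x).aestronglyMeasurable)
    (integrable_twist L f G x) (continuous_dTwist L f G x).aestronglyMeasurable
    (Filter.Eventually.of_forall fun u x _ => norm_dTwist_le L f G x u) hb
    (Filter.Eventually.of_forall fun u x _ => hasFDerivAt_integrand L f G x u)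

theorem fderiv_twist_apply (L : V n →L[ℝ] V n) (f G : 𝓢(V n, A)) (x e : V n) :
    fderiv ℝ (twist L f G) x e = twist L (dirDeriv e f) G x + twist L f (momentum e G) x := by
  obtain ⟨hi, hd⟩ := hasFDerivAt_twist L f G x
  rw [hd.fderiv, ContinuousLinearMap.integral_apply hi, twist, twist,
    ← integral_add (integrable_twist _ _ _ _) (integrable_twist _ _ _ _)]
  congr 1
  ext u
  simp only [dTwist, momentum_apply, dirDeriv_apply]
  simp only [add_apply, smul_apply, ContinuousLinearMap.comp_apply, ContinuousLinearMap.flip_apply,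
    ContinuousLinearMap.mul_apply', ContinuousLinearMap.smulRight_apply, innerSL_apply_apply,
    mul_smul_comm, smul_smul]
  rw [← Complex.coe_smul, smul_smul]
  congr 2
  ring

theorem contDiff_twist (L : V n →L[ℝ] V n) (N : ℕ) (f G : 𝓢(V n, A)) :
    ContDiff ℝ N (twist L f G) := by
  induction N generalizing f G with
  | zero =>
    simp only [Nat.cast_zero, contDiff_zero]
    exact continuous_iff_continuousAt.2 fun x => (hasFDerivAt_twist L f G x).2.continuousAt
  | succ N ih =>
    push_cast
    rw [contDiff_succ_iff_fderiv_apply]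
    refine ⟨fun x => (hasFDerivAt_twist L f G x).2.differentiableAt, by simp, fun e => ?_⟩
    simp_rw [fderiv_twist_apply]
    exact (ih _ _).add (ih _ _)

theorem decay_twist_zero (L : V n →L[ℝ] V n) (k : ℕ) (f G : 𝓢(V n, A)) :
    ∃ C, ∀ x, ‖x‖ ^ k * ‖twist L f G x‖ ≤ C := by
  refine ⟨∫ u, 2 ^ k * (SchwartzMap.seminorm ℝ k 0 f * ‖G u‖ +
    ‖L‖ ^ k * SchwartzMap.seminorm ℝ 0 0 f * (‖u‖ ^ k * ‖G u‖)), fun x => ?_⟩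
  have hb : Integrable fun u : V n => 2 ^ k * (SchwartzMap.seminorm ℝ k 0 f * ‖G u‖ +
    ‖L‖ ^ k * SchwartzMap.seminorm ℝ 0 0 f * (‖u‖ ^ k * ‖G u‖)) :=
    ((G.integrable.norm.const_mul _).add ((G.integrable_pow_mul volume k).const_mul _)).const_mul _
  rw [twist]
  calc ‖x‖ ^ k * ‖∫ u, phase (-u) x • (f (x + L u) * G u)‖
      ≤ ‖x‖ ^ k * ∫ u, ‖phase (-u) x • (f (x + L u) * G u)‖ := by
        gcongr; exact norm_integral_le_integral_norm _
    _ = ∫ u, ‖x‖ ^ k * ‖phase (-u) x • (f (x + L u) * G u)‖ := by rw [integral_const_mul]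
    _ ≤ _ := by
      refine integral_mono ((integrable_twist L f G x).norm.const_mul _) hb fun u => ?_
      simp only [norm_smul, norm_phase, one_mul]
      have h1 : ‖x‖ ≤ ‖x + L u‖ + ‖L‖ * ‖u‖ := by
        calc ‖x‖ = ‖(x + L u) - L u‖ := by simp
          _ ≤ ‖x + L u‖ + ‖L u‖ := norm_sub_le _ _
          _ ≤ _ := by gcongr; exact L.le_opNorm u
      have h2 : ‖x‖ ^ k ≤ 2 ^ k * (‖x + L u‖ ^ k + (‖L‖ * ‖u‖) ^ k) := by
        calc ‖x‖ ^ k ≤ (‖x + L u‖ + ‖L‖ * ‖u‖) ^ k := by gcongr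
          _ ≤ 2 ^ (k - 1) * (‖x + L u‖ ^ k + (‖L‖ * ‖u‖) ^ k) :=
            add_pow_le (norm_nonneg _) (by positivity) k
          _ ≤ _ := by gcongr <;> simp
      have h3 := f.norm_pow_mul_le_seminorm ℝ k (x + L u)
      have h4 := f.norm_le_seminorm ℝ (x + L u)
      calc ‖x‖ ^ k * ‖f (x + L u) * G u‖
          ≤ (2 ^ k * (‖x + L u‖ ^ k + (‖L‖ * ‖u‖) ^ k)) * (‖f (x + L u)‖ * ‖G u‖) := by
            gcongr; exact norm_mul_le _ _
        _ = 2 ^ k * ((‖x + L u‖ ^ k * ‖f (x + L u)‖) * ‖G u‖ +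
              ‖L‖ ^ k * ‖f (x + L u)‖ * (‖u‖ ^ k * ‖G u‖)) := by ring
        _ ≤ _ := by gcongr

theorem decay_twist (L : V n →L[ℝ] V n) (k N : ℕ) (f G : 𝓢(V n, A)) :
    ∃ C, ∀ x, ‖x‖ ^ k * ‖iteratedFDeriv ℝ N (twist L f G) x‖ ≤ C := by
  induction N generalizing f G with
  | zero => simpa using decay_twist_zero L k f G
  | succ N ih =>
    let b := EuclideanSpace.basisFun (Fin n) ℝ
    let D : Fin n → V n → A := fun i x =>
      twist L (dirDeriv (b i) f) G x + twist L f (momentum (b i) G) x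
    let Φ : Fin n → A →L[ℝ] (V n →L[ℝ] A) := fun i =>
      ContinuousLinearMap.smulRightL ℝ (V n) A (innerSL ℝ (b i))
    have hD : ∀ i, ContDiff ℝ N (D i) := fun i =>
      (contDiff_twist L N _ _).add (contDiff_twist L N _ _)
    have hfd : fderiv ℝ (twist L f G) = fun x => ∑ i, (Φ i ∘ D i) x := by
      ext x v
      have hv : v = ∑ i, (inner ℝ (b i) v : ℝ) • b i := (b.sum_repr' v).symm
      conv_lhs => rw [hv]
      simp only [map_sum, map_smul, fderiv_twist_apply]
      simp [Φ, D]
    have hdec : ∀ i, ∃ C, ∀ x, ‖x‖ ^ k * ‖iteratedFDeriv ℝ N (D i) x‖ ≤ C := fun i => by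
      obtain ⟨C₁, h₁⟩ := ih (dirDeriv (b i) f) G
      obtain ⟨C₂, h₂⟩ := ih f (momentum (b i) G)
      refine ⟨C₁ + C₂, fun x => ?_⟩
      have : iteratedFDeriv ℝ N (D i) x = _ := iteratedFDeriv_add_apply
        (contDiff_twist L N (dirDeriv (b i) f) G).contDiffAt
        (contDiff_twist L N f (momentum (b i) G)).contDiffAt
      rw [this]
      calc _ ≤ ‖x‖ ^ k * (_ + _) := by gcongr; exact norm_add_le _ _
        _ ≤ _ := by rw [mul_add]; exact add_le_add (h₁ x) (h₂ x)
    choose C hC using hdec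
    refine ⟨∑ i, ‖Φ i‖ * C i, fun x => ?_⟩
    rw [← norm_iteratedFDeriv_fderiv, hfd, iteratedFDeriv_fun_sum_apply fun i _ =>
      ((Φ i).contDiff.comp (hD i)).contDiffAt]
    calc _ ≤ ‖x‖ ^ k * ∑ i, ‖iteratedFDeriv ℝ N (Φ i ∘ D i) x‖ := by
          gcongr; exact norm_sum_le _ _
      _ = ∑ i, ‖x‖ ^ k * ‖iteratedFDeriv ℝ N (Φ i ∘ D i) x‖ := by rw [Finset.mul_sum]
      _ ≤ _ := by
        refine Finset.sum_le_sum fun i _ => ?_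
        calc _ ≤ ‖x‖ ^ k * (‖Φ i‖ * ‖iteratedFDeriv ℝ N (D i) x‖) := by
              gcongr
              exact (Φ i).norm_iteratedFDeriv_comp_left (hD i).contDiffAt le_rfl
          _ = ‖Φ i‖ * (‖x‖ ^ k * ‖iteratedFDeriv ℝ N (D i) x‖) := by ring
          _ ≤ _ := by gcongr; exact hC i x

theorem phase_neg_right (u x : V n) : phase u (-x) = phase (-u) x := by simp [phase]

theorem phase_add_right (u x y : V n) : phase u (x + y) = phase u x * phase u y := by
  simp [phase, inner_add_right, mul_add, Complex.exp_add]

theorem phase_mul_phase_neg (u x : V n) : phase (-u) x * phase u x = 1 := by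
  simp [phase, ← Complex.exp_add]

theorem star_phase (u x : V n) : star (phase u x) = phase (-u) x := by
  simp [phase, ← Complex.exp_conj]

theorem hasTemperateGrowth_phase (u : V n) : (fun x => phase u x).HasTemperateGrowth := by
  have hD : ∀ k : ℕ, iteratedDeriv k (fun t : ℝ => Complex.exp (Complex.I * t)) =
      fun t : ℝ => Complex.I ^ k * Complex.exp (Complex.I * t) := by
    intro k
    induction k with
    | zero => simp
    | succ k ih =>
      rw [iteratedDeriv_succ, ih]
      ext t
      have h1 : HasDerivAt (fun t : ℝ => Complex.I * (t : ℂ)) (Complex.I * 1) t :=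
        (Complex.ofRealCLM.hasDerivAt (x := t)).const_mul Complex.I
      rw [(h1.cexp.const_mul (Complex.I ^ k)).deriv]
      ring
  have hexp : (fun t : ℝ => Complex.exp (Complex.I * t)).HasTemperateGrowth := by
    refine ⟨(contDiff_const.mul Complex.ofRealCLM.contDiff).cexp, fun k => ⟨0, 1, fun t => ?_⟩⟩
    rw [norm_iteratedFDeriv_eq_norm_iteratedDeriv, hD, norm_mul, norm_pow, Complex.norm_I,
      mul_comm Complex.I, Complex.norm_exp_ofReal_mul_I]
    simp
  exact hexp.comp (Function.hasTemperateGrowth_inner_right u)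

/-- `u ↦ ∫ e^{i ⟨u, w⟩} g(w) dw` as a Schwartz function. -/
noncomputable def expTransform (g : 𝓢(V n, A)) : 𝓢(V n, A) :=
  SchwartzMap.compCLMOfContinuousLinearEquiv ℂ
    (ContinuousLinearEquiv.smulLeft (R₁ := ℝ) (M₁ := V n)
      (Units.mk0 (-(2 * Real.pi)⁻¹) (neg_ne_zero.2 (inv_ne_zero Real.two_pi_pos.ne')) : ℝˣ))
    (FourierTransform.fourier g)

theorem expTransform_apply (g : 𝓢(V n, A)) (u : V n) :
    expTransform g u = ∫ w, phase u w • g w := by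
  have : expTransform g u = FourierTransform.fourier g ((-(2 * Real.pi)⁻¹ : ℝ) • u) := rfl
  rw [this, SchwartzMap.fourier_coe, Real.fourier_eq']
  congr 1
  ext w
  rw [phase, inner_smul_right, real_inner_comm]
  congr 2
  have := Real.pi_pos.ne'
  push_cast
  field_simp

theorem integrable_phase_smul (u : V n) (g : 𝓢(V n, A)) : Integrable fun w => phase u w • g w := by
  refine g.integrable (μ := volume) |>.norm.mono' ?_ (.of_forall fun w => ?_)
  · have : Continuous fun w : V n => phase u w :=
      continuous_phase.comp (by fun_prop : Continuous fun w : V n => (u, w))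
    exact (this.smul g.continuous).aestronglyMeasurable
  · rw [norm_smul, norm_phase, one_mul]

theorem iterated_eq_twist (L : V n →L[ℝ] V n) (f g : 𝓢(V n, A)) (x : V n) :
    ∫ u, ∫ v, phase u v • (f (x + L u) * g (x + v)) = twist L f (expTransform g) x := by
  rw [twist]
  congr 1
  ext u
  rw [expTransform_apply, ← integral_add_left_eq_self (fun w => phase u w • g w) x]
  have h : Integrable fun v => phase u (x + v) • g (x + v) :=
    (integrable_phase_smul u g).comp_add_left x
  rw [← integral_const_mul_of_integrable h, ← integral_smul]
  congr 1
  ext v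
  rw [mul_smul_comm, smul_smul, phase_add_right, ← mul_assoc, phase_mul_phase_neg, one_mul]

/-- The deformed product of two Schwartz functions,
`(f ×_J g)(x) = (2π)^{-n} ∫ (∫ f(x + J u) g(x + v) e^{i u·v} dv) du`.
The integrand is in general not absolutely integrable on `ℝⁿ × ℝⁿ`: the integral is an oscillatory
one. For Schwartz functions it is the above iterated integral (inner integral in `v`, outer one in
`u`, both absolutely convergent), see `isOscillatoryIntegral_deformedMul`. -/
noncomputable def deformedMul (J : Matrix (Fin n) (Fin n) ℝ) (f g : 𝓢(V n, A)) : 𝓢(V n, A) where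
  toFun x := ((2 * Real.pi) ^ n)⁻¹ •
    ∫ u, ∫ v, phase u v • (f (x + Matrix.toEuclideanCLM (𝕜 := ℝ) J u) * g (x + v))
  smooth' := by
    simp_rw [iterated_eq_twist]
    exact (contDiff_infty.2 fun N => contDiff_twist _ N _ _).const_smul _
  decay' k N := by
    obtain ⟨C, hC⟩ := decay_twist (Matrix.toEuclideanCLM (𝕜 := ℝ) J) k N f (expTransform g)
    refine ⟨‖((2 * Real.pi) ^ n)⁻¹‖ * C, fun x => ?_⟩
    simp_rw [iterated_eq_twist]
    rw [iteratedFDeriv_const_smul_apply' (contDiff_twist _ N _ _).contDiffAt, norm_smul,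
      mul_left_comm]
    gcongr
    exact hC x

theorem deformedMul_apply (J : Matrix (Fin n) (Fin n) ℝ) (f g : 𝓢(V n, A)) (x : V n) :
    deformedMul J f g x = ((2 * Real.pi) ^ n)⁻¹ •
      ∫ u, ∫ v, phase u v • (f (x + Matrix.toEuclideanCLM (𝕜 := ℝ) J u) * g (x + v)) := rfl

theorem deformedMul_eq_twist (J : Matrix (Fin n) (Fin n) ℝ) (f g : 𝓢(V n, A)) (x : V n) :
    deformedMul J f g x = ((2 * Real.pi) ^ n)⁻¹ •
      twist (Matrix.toEuclideanCLM (𝕜 := ℝ) J) f (expTransform g) x := by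
  rw [deformedMul_apply, iterated_eq_twist]

/-- `⟨f, g⟩ = ∫ f(x)* g(x) dx`. -/
noncomputable def innerInt (f g : 𝓢(V n, A)) : A :=
  ∫ x, star (f x) * g x

theorem integrable_star_mul (f g : 𝓢(V n, A)) : Integrable fun x => star (f x) * g x := by
  refine (g.integrable (μ := volume)).norm.const_mul (SchwartzMap.seminorm ℝ 0 0 f) |>.mono' ?_ ?_
  · exact (f.continuous.star.mul g.continuous).aestronglyMeasurable
  · refine .of_forall fun x => (norm_mul_le _ _).trans ?_
    rw [norm_star]
    gcongr
    exact f.norm_le_seminorm ℝ x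

theorem innerInt_add_right (f g h : 𝓢(V n, A)) :
    innerInt f (g + h) = innerInt f g + innerInt f h := by
  simp only [innerInt, add_apply, mul_add]
  exact integral_add (integrable_star_mul f g) (integrable_star_mul f h)

theorem innerInt_smul_right (c : ℂ) (f g : 𝓢(V n, A)) :
    innerInt f (c • g) = c • innerInt f g := by
  simp only [innerInt, smul_apply, mul_smul_comm, integral_smul]

theorem star_innerInt (f g : 𝓢(V n, A)) : star (innerInt f g) = innerInt g f := by
  have := ((starL' ℝ : A ≃L[ℝ] A) : A →L[ℝ] A).integral_comp_comm (integrable_star_mul f g)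
  simp only [ContinuousLinearEquiv.coe_coe, starL'_apply, star_mul, star_star] at this
  exact this.symm

theorem innerInt_add_left (f g h : 𝓢(V n, A)) :
    innerInt (f + g) h = innerInt f h + innerInt g h := by
  rw [← star_innerInt, innerInt_add_right, star_add, star_innerInt, star_innerInt]

theorem innerInt_smul_left (c : ℂ) (f g : 𝓢(V n, A)) :
    innerInt (c • f) g = star c • innerInt f g := by
  rw [← star_innerInt, innerInt_smul_right, star_smul, star_innerInt]

/-- `‖f‖₂ = ‖⟨f, f⟩‖^{1/2}`. -/
noncomputable def norm₂ (f : 𝓢(V n, A)) : ℝ := √‖innerInt f f‖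

theorem norm₂_sq (f : 𝓢(V n, A)) : norm₂ f ^ 2 = ‖innerInt f f‖ := Real.sq_sqrt (norm_nonneg _)

theorem norm₂_nonneg (f : 𝓢(V n, A)) : 0 ≤ norm₂ f := Real.sqrt_nonneg _

/-- The right multiplication of a function by an element of `A`. -/
noncomputable def mulConst (f : 𝓢(V n, A)) (a : A) : 𝓢(V n, A) :=
  f.postcompCLM ((ContinuousLinearMap.mul ℂ A).flip a)

theorem mulConst_apply (f : 𝓢(V n, A)) (a : A) (x : V n) : mulConst f a x = f x * a := rfl

theorem innerInt_mulConst_right (f g : 𝓢(V n, A)) (a : A) :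
    innerInt f (mulConst g a) = innerInt f g * a := by
  simp only [innerInt, mulConst_apply, ← mul_assoc]
  exact integral_mul_const_of_integrable (integrable_star_mul f g)

theorem innerInt_mulConst_left (f g : 𝓢(V n, A)) (a : A) :
    innerInt (mulConst f a) g = star a * innerInt f g := by
  rw [← star_innerInt, innerInt_mulConst_right, star_mul, star_innerInt]

theorem norm_innerInt_le (f g : 𝓢(V n, A)) : ‖innerInt f g‖ ≤ norm₂ f * norm₂ g := by
  let _ : PartialOrder A := CStarAlgebra.spectralOrder A
  have _ : StarOrderedRing A := CStarAlgebra.spectralOrderedRing A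
  have hpos : ∀ h : 𝓢(V n, A), 0 ≤ innerInt h h := fun h =>
    integral_nonneg fun x => star_mul_self_nonneg (h x)
  have key : ∀ t : ℝ, norm₂ f ^ 2 ≤ t → ‖innerInt f g‖ ^ 2 ≤ t * norm₂ g ^ 2 ∨ t = 0 := by
    intro t ht
    by_cases ht0 : t = 0
    · exact .inr ht0
    have htp : 0 < t := lt_of_le_of_ne ((sq_nonneg _).trans ht) (Ne.symm ht0)
    left
    set a := innerInt f g with ha
    have hga : innerInt g f = star a := (star_innerInt f g).symm
    have h0 := hpos (mulConst f a + (-(t : ℂ)) • g)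
    have hle : star a * innerInt f f * a ≤ t • (star a * a) := by
      have hsa : IsSelfAdjoint (innerInt f f) := star_innerInt f f
      refine (CStarAlgebra.star_left_conjugate_le_norm_smul (b := innerInt f f) hsa).trans ?_
      rw [← norm₂_sq]
      exact smul_le_smul_of_nonneg_right ht (star_mul_self_nonneg a)
    have hexp : innerInt (mulConst f a + (-(t : ℂ)) • g) (mulConst f a + (-(t : ℂ)) • g) =
        star a * innerInt f f * a - t • (star a * a) - t • (star a * a) +
          t • t • innerInt g g := by
      simp only [innerInt_add_left, innerInt_add_right, innerInt_smul_left, innerInt_smul_right,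
        innerInt_mulConst_left, innerInt_mulConst_right, hga, ← ha]
      simp only [star_neg, Complex.star_def, Complex.conj_ofReal, neg_smul, smul_add, smul_neg,
        Complex.coe_smul, add_mul, neg_mul, smul_mul_assoc]
      abel
    rw [hexp] at h0
    have h1 : t • (star a * a) ≤ t • t • innerInt g g := by
      have := h0.trans (add_le_add_left (sub_le_sub_right (sub_le_sub_right hle _) _) _)
      rw [sub_self, zero_sub, neg_add_eq_sub, sub_nonneg] at this
      exact this
    have h2 : star a * a ≤ t • innerInt g g := (smul_le_smul_iff_of_pos_left htp).1 h1
    have h3 := CStarAlgebra.norm_le_norm_of_nonneg_of_le (star_mul_self_nonneg a) h2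
    rw [CStarRing.norm_star_mul_self, norm_smul, ← norm₂_sq, Real.norm_of_nonneg htp.le,
      ← pow_two] at h3
    exact h3
  have h4 : ‖innerInt f g‖ ^ 2 ≤ norm₂ f ^ 2 * norm₂ g ^ 2 := by
    have h5 : ∀ ε : ℝ, 0 < ε → ‖innerInt f g‖ ^ 2 ≤ (norm₂ f ^ 2 + ε) * norm₂ g ^ 2 := fun ε hε =>
      (key (norm₂ f ^ 2 + ε) (by linarith)).resolve_right (by positivity)
    refine ge_of_tendsto (x := nhdsWithin (0 : ℝ) (Set.Ioi 0))
      (f := fun ε : ℝ => (norm₂ f ^ 2 + ε) * norm₂ g ^ 2) ?_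
      (Filter.eventually_of_mem self_mem_nhdsWithin fun ε hε => h5 ε hε)
    have : Continuous fun ε : ℝ => (norm₂ f ^ 2 + ε) * norm₂ g ^ 2 := by fun_prop
    simpa using (this.tendsto 0).mono_left nhdsWithin_le_nhds
  rw [← mul_pow] at h4
  exact (pow_le_pow_iff_left₀ (norm_nonneg _) (mul_nonneg (norm₂_nonneg _) (norm₂_nonneg _))
    two_ne_zero).1 h4

theorem norm₂_add_le (f g : 𝓢(V n, A)) : norm₂ (f + g) ≤ norm₂ f + norm₂ g := by
  refine (pow_le_pow_iff_left₀ (norm₂_nonneg _)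
    (add_nonneg (norm₂_nonneg _) (norm₂_nonneg _)) two_ne_zero).1 ?_
  rw [norm₂_sq, innerInt_add_left, innerInt_add_right, innerInt_add_right]
  have h1 := norm_innerInt_le f g
  have h2 := norm_innerInt_le g f
  calc _ ≤ (‖innerInt f f‖ + ‖innerInt f g‖) + (‖innerInt g f‖ + ‖innerInt g g‖) :=
        (norm_add_le _ _).trans (add_le_add (norm_add_le _ _) (norm_add_le _ _))
    _ ≤ (norm₂ f ^ 2 + norm₂ f * norm₂ g) + (norm₂ g * norm₂ f + norm₂ g ^ 2) := by
        rw [norm₂_sq, norm₂_sq]; gcongr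
    _ = _ := by ring

theorem norm₂_smul (c : ℂ) (f : 𝓢(V n, A)) : norm₂ (c • f) = ‖c‖ * norm₂ f := by
  rw [norm₂, innerInt_smul_left, innerInt_smul_right, norm_smul, norm_smul, ← mul_assoc, norm_star,
    Real.sqrt_mul (by positivity), Real.sqrt_mul_self (norm_nonneg _), norm₂]

/-- `T_z f(x) = f(x - z)`. -/
noncomputable def shift (z : V n) (f : 𝓢(V n, A)) : 𝓢(V n, A) :=
  SchwartzMap.compSubConstCLM ℂ z f

theorem shift_apply (z : V n) (f : 𝓢(V n, A)) (x : V n) : shift z f x = f (x - z) := rfl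

/-- `M_ζ f(x) = e^{i ζ·x} f(x)`. -/
noncomputable def modulate (ζ : V n) (f : 𝓢(V n, A)) : 𝓢(V n, A) :=
  SchwartzMap.smulLeftCLM A (fun x => phase ζ x) f

theorem modulate_apply (ζ : V n) (f : 𝓢(V n, A)) (x : V n) :
    modulate ζ f x = phase ζ x • f x :=
  SchwartzMap.smulLeftCLM_apply_apply (hasTemperateGrowth_phase ζ) f x

theorem innerInt_shift (z : V n) (f g : 𝓢(V n, A)) :
    innerInt (shift z f) (shift z g) = innerInt f g :=
  integral_sub_right_eq_self (fun x => star (f x) * g x) z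

theorem innerInt_modulate (ζ : V n) (f g : 𝓢(V n, A)) :
    innerInt (modulate ζ f) (modulate ζ g) = innerInt f g := by
  simp only [innerInt, modulate_apply, star_smul, star_phase, smul_mul_smul_comm,
    phase_mul_phase_neg, one_smul]

theorem norm₂_shift (z : V n) (f : 𝓢(V n, A)) : norm₂ (shift z f) = norm₂ f := by
  rw [norm₂, innerInt_shift, norm₂]

theorem norm₂_modulate (ζ : V n) (f : 𝓢(V n, A)) : norm₂ (modulate ζ f) = norm₂ f := by
  rw [norm₂, innerInt_modulate, norm₂]

theorem norm₂_deformedMul_le (J : Matrix (Fin n) (Fin n) ℝ) (f g : 𝓢(V n, A)) :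
    norm₂ (deformedMul J f g) ≤
      (((2 * Real.pi) ^ n)⁻¹ * ∫ u, ‖expTransform g u‖) * norm₂ f := by
  set k := deformedMul J f g with hk
  set G := expTransform g
  set L := Matrix.toEuclideanCLM (𝕜 := ℝ) J
  set c : ℝ := ((2 * Real.pi) ^ n)⁻¹
  have hc : 0 ≤ c := by positivity
  have hint : Integrable (Function.uncurry fun x u : V n =>
      star (k x) * (phase (-u) x • (f (x + L u) * G u))) (volume.prod volume) := by
    have hd : Integrable (fun p : V n × V n => ‖k p.1‖ * (SchwartzMap.seminorm ℝ 0 0 f * ‖G p.2‖))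
        (volume.prod volume) :=
      (k.integrable (μ := volume)).norm.mul_prod
        ((G.integrable (μ := volume)).norm.const_mul (SchwartzMap.seminorm ℝ 0 0 f))
    refine hd.mono' ?_ (.of_forall fun p => ?_)
    · have h1 := k.continuous
      have h2 := f.continuous
      have h3 := G.continuous
      have h4 : Continuous fun p : V n × V n => phase (-p.2) p.1 :=
        continuous_phase.comp (by fun_prop : Continuous fun p : V n × V n => (-p.2, p.1))
      refine Continuous.aestronglyMeasurable ?_
      simp only [Function.uncurry_def]
      fun_prop
    · simp only [Function.uncurry_def]
      refine (norm_mul_le _ _).trans ?_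
      rw [norm_star, norm_smul, norm_phase, one_mul]
      gcongr
      refine (norm_mul_le _ _).trans ?_
      gcongr
      exact f.norm_le_seminorm ℝ _
  have hkk : innerInt k k =
      c • ∫ u, innerInt k (modulate (-u) (shift (-(L u)) f)) * G u := by
    calc innerInt k k = ∫ x, c • ∫ u, star (k x) * (phase (-u) x • (f (x + L u) * G u)) := by
          rw [innerInt]
          congr 1
          ext x
          rw [integral_const_mul_of_integrable (integrable_twist L f G x), ← mul_smul_comm]
          congr 1
          exact deformedMul_eq_twist J f g x
      _ = c • ∫ x, ∫ u, star (k x) * (phase (-u) x • (f (x + L u) * G u)) := integral_smul _ _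
      _ = c • ∫ u, ∫ x, star (k x) * (phase (-u) x • (f (x + L u) * G u)) := by
          rw [integral_integral_swap hint]
      _ = _ := by
          congr 2
          ext u
          rw [innerInt, ← integral_mul_const_of_integrable (integrable_star_mul _ _)]
          congr 1
          ext x
          rw [modulate_apply, shift_apply, sub_neg_eq_add, ← smul_mul_assoc, mul_assoc]
  have hle : norm₂ k ^ 2 ≤ norm₂ k * ((c * ∫ u, ‖G u‖) * norm₂ f) := by
    rw [norm₂_sq, hkk, norm_smul, Real.norm_of_nonneg hc]
    calc c * ‖∫ u, innerInt k (modulate (-u) (shift (-(L u)) f)) * G u‖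
        ≤ c * ∫ u, (norm₂ k * norm₂ f) * ‖G u‖ := by
          gcongr
          refine norm_integral_le_of_norm_le (G.integrable.norm.const_mul _) (.of_forall fun u => ?_)
          refine (norm_mul_le _ _).trans ?_
          gcongr
          refine (norm_innerInt_le _ _).trans_eq ?_
          rw [norm₂_modulate, norm₂_shift]
      _ = _ := by rw [integral_const_mul]; ring
  rcases (norm₂_nonneg k).eq_or_lt with h | h
  · rw [← h]
    exact mul_nonneg (mul_nonneg hc (integral_nonneg fun _ => norm_nonneg _)) (norm₂_nonneg _)
  · rw [pow_two] at hle
    exact le_of_mul_le_mul_left hle h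

/-- The sequences of cutoff functions that define oscillatory integrals: test functions with all
derivatives bounded uniformly in `m`, and equal to `1` on balls of radii tending to infinity. -/
structure IsCutoff (ψ : ℕ → V n → ℝ) : Prop where
  smooth : ∀ m, ContDiff ℝ ∞ (ψ m)
  compact : ∀ m, HasCompactSupport (ψ m)
  bounded : ∀ k : ℕ, ∃ c, ∀ m x, ‖iteratedFDeriv ℝ k (ψ m) x‖ ≤ c
  eq_one : ∃ r : ℕ → ℝ, Filter.Tendsto r .atTop .atTop ∧ ∀ m x, ‖x‖ < r m → ψ m x = 1

/-- `a` is the oscillatory integral of `Φ` over `ℝⁿ × ℝⁿ`: the limit, in both indices, of the integrals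
with cutoffs, for all choices of the cutoff sequences. -/
def IsOscillatoryIntegral (Φ : V n → V n → A) (a : A) : Prop :=
  ∀ ψ ψ' : ℕ → V n → ℝ, IsCutoff ψ → IsCutoff ψ' →
    Filter.Tendsto (fun p : ℕ × ℕ => ∫ u, ∫ v, (ψ p.1 u * ψ' p.2 v) • Φ u v) .atTop (nhds a)

theorem IsCutoff.tendsto_one {ψ : ℕ → V n → ℝ} (h : IsCutoff ψ) (x : V n) :
    Filter.Tendsto (fun m => ψ m x) .atTop (nhds 1) := by
  obtain ⟨r, hr, h1⟩ := h.eq_one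
  refine tendsto_const_nhds.congr' ?_
  filter_upwards [hr.eventually_gt_atTop ‖x‖] with m hm
  exact (h1 m x hm).symm

theorem IsCutoff.seminorm_le {ψ : ℕ → V n → ℝ} (h : IsCutoff ψ) (g : 𝓢(V n, A)) (K N : ℕ) :
    ∃ C, ∀ m, SchwartzMap.seminorm ℝ K N (SchwartzMap.smulLeftCLM A (ψ m) g) ≤ C := by
  choose c hc using h.bounded
  have hc0 : ∀ k, 0 ≤ c k := fun k => (norm_nonneg _).trans (hc k 0 0)
  refine ⟨∑ i ∈ Finset.range (N + 1), (N.choose i : ℝ) * c i *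
    SchwartzMap.seminorm ℝ K (N - i) g, fun m => ?_⟩
  have ht : (ψ m).HasTemperateGrowth := (h.compact m).hasTemperateGrowth (h.smooth m)
  refine SchwartzMap.seminorm_le_bound ℝ K N _ (Finset.sum_nonneg fun i _ => ?_) fun x => ?_
  · have := hc0 i; positivity
  · rw [SchwartzMap.smulLeftCLM_apply ht]
    have := norm_iteratedFDeriv_smul_le (𝕜 := ℝ) (h.smooth m) (g.smooth ⊤) x (n := N)
      (by exact_mod_cast le_top)
    calc _ ≤ ‖x‖ ^ K * _ := mul_le_mul_of_nonneg_left this (by positivity)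
      _ ≤ _ := by
        rw [Finset.mul_sum]
        refine Finset.sum_le_sum fun i _ => ?_
        calc _ = (N.choose i : ℝ) * ‖iteratedFDeriv ℝ i (ψ m) x‖ *
              (‖x‖ ^ K * ‖iteratedFDeriv ℝ (N - i) g x‖) := by ring
          _ ≤ _ := by
            gcongr
            · have := hc0 i; positivity
            · exact hc i m x
            · exact g.le_seminorm ℝ K (N - i) x

theorem IsCutoff.expTransform_le {ψ : ℕ → V n → ℝ} (h : IsCutoff ψ) (g : 𝓢(V n, A)) (K : ℕ) :
    ∃ C, ∀ m u, ‖u‖ ^ K * ‖expTransform (SchwartzMap.smulLeftCLM A (ψ m) g) u‖ ≤ C := by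
  let T : 𝓢(V n, A) →L[ℂ] 𝓢(V n, A) := (SchwartzMap.compCLMOfContinuousLinearEquiv ℂ
    (ContinuousLinearEquiv.smulLeft (R₁ := ℝ) (M₁ := V n)
      (Units.mk0 (-(2 * Real.pi)⁻¹) (neg_ne_zero.2 (inv_ne_zero Real.two_pi_pos.ne')) : ℝˣ))).comp
    (SchwartzMap.fourierTransformCLM ℂ)
  let q : Seminorm ℂ 𝓢(V n, A) := (SchwartzMap.seminorm ℂ K 0).comp T.toLinearMap
  have hq : Continuous q :=
    ((schwartz_withSeminorms ℂ (V n) A).continuous_seminorm (K, 0)).comp T.continuous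
  obtain ⟨s, C, -, hC⟩ := Seminorm.bound_of_continuous (schwartz_withSeminorms ℂ (V n) A) q hq
  choose c hc using fun i : ℕ × ℕ => h.seminorm_le g i.1 i.2
  have hc0 : ∀ i, 0 ≤ c i := fun i => (apply_nonneg _ _).trans (hc i 0)
  refine ⟨C * ∑ i ∈ s, c i, fun m u => ?_⟩
  calc _ ≤ SchwartzMap.seminorm ℂ K 0 (expTransform (SchwartzMap.smulLeftCLM A (ψ m) g)) :=
        SchwartzMap.norm_pow_mul_le_seminorm ℂ _ K u
    _ ≤ C * (s.sup (schwartzSeminormFamily ℂ (V n) A)) (SchwartzMap.smulLeftCLM A (ψ m) g) :=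
        hC (SchwartzMap.smulLeftCLM A (ψ m) g)
    _ ≤ _ := by
      gcongr
      refine Seminorm.finset_sup_apply_le (Finset.sum_nonneg fun i _ => hc0 i) fun i hi => ?_
      exact (hc i m).trans (Finset.single_le_sum (f := c) (fun i _ => hc0 i) hi)

theorem isOscillatoryIntegral_iterated (L : V n →L[ℝ] V n) (f g : 𝓢(V n, A)) (x : V n) :
    IsOscillatoryIntegral (fun u v => phase u v • (f (x + L u) * g (x + v)))
      (∫ u, ∫ v, phase u v • (f (x + L u) * g (x + v))) := by
  intro ψ ψ' hψ hψ'
  set h : 𝓢(V n, A) := shift (-x) g with hh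
  have hgx : ∀ v, g (x + v) = h v := fun v => by rw [hh, shift_apply, sub_neg_eq_add, add_comm]
  have hsm : ∀ k v, SchwartzMap.smulLeftCLM A (ψ' k) h v = ψ' k v • h v := fun k v =>
    SchwartzMap.smulLeftCLM_apply_apply ((hψ'.compact k).hasTemperateGrowth (hψ'.smooth k)) h v
  have hin : ∀ (p : ℕ × ℕ) u, ∫ v, (ψ p.1 u * ψ' p.2 v) • phase u v • (f (x + L u) * g (x + v)) =
      ψ p.1 u • (f (x + L u) * expTransform (SchwartzMap.smulLeftCLM A (ψ' p.2) h) u) := by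
    intro p u
    rw [expTransform_apply, ← integral_const_mul_of_integrable (integrable_phase_smul u _),
      ← integral_smul]
    congr 1
    ext v
    rw [hsm, hgx, mul_smul, mul_smul_comm, mul_smul_comm, smul_comm (ψ' p.2 v)]
  have hlim : ∀ u, ∫ v, phase u v • (f (x + L u) * g (x + v)) =
      f (x + L u) * expTransform h u := by
    intro u
    rw [expTransform_apply, ← integral_const_mul_of_integrable (integrable_phase_smul u _)]
    congr 1
    ext v
    rw [hgx, mul_smul_comm]
  simp only [hin, hlim]
  obtain ⟨c, hc⟩ := hψ.bounded 0
  obtain ⟨c', hc'⟩ := hψ'.bounded 0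
  simp only [norm_iteratedFDeriv_zero] at hc hc'
  have hc0 : 0 ≤ c := (norm_nonneg _).trans (hc 0 0)
  obtain ⟨C₀, hC₀⟩ := hψ'.expTransform_le h 0
  obtain ⟨C₁, hC₁⟩ := hψ'.expTransform_le h (n + 1)
  have hb : ∀ k u, ‖expTransform (SchwartzMap.smulLeftCLM A (ψ' k) h) u‖ ≤
      (2 ^ n * (C₀ + C₁)) * (1 + ‖u‖) ^ (-((n : ℝ) + 1)) := by
    intro k u
    have h0 : 0 < 1 + ‖u‖ := by positivity
    have hcast : ((n : ℝ) + 1) = ((n + 1 : ℕ) : ℝ) := by push_cast; rfl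
    rw [hcast, Real.rpow_neg h0.le, Real.rpow_natCast, ← div_eq_mul_inv, le_div_iff₀ (by positivity),
      mul_comm]
    calc _ ≤ (2 ^ n * (1 ^ (n + 1) + ‖u‖ ^ (n + 1))) *
          ‖expTransform (SchwartzMap.smulLeftCLM A (ψ' k) h) u‖ := by
          gcongr
          exact add_pow_le zero_le_one (norm_nonneg u) (n + 1)
      _ = 2 ^ n * (‖u‖ ^ 0 * ‖expTransform (SchwartzMap.smulLeftCLM A (ψ' k) h) u‖ +
          ‖u‖ ^ (n + 1) * ‖expTransform (SchwartzMap.smulLeftCLM A (ψ' k) h) u‖) := by ring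
      _ ≤ _ := by gcongr; exacts [hC₀ k u, hC₁ k u]
  have hpt : ∀ u, Filter.Tendsto
      (fun k => expTransform (SchwartzMap.smulLeftCLM A (ψ' k) h) u) .atTop
      (nhds (expTransform h u)) := by
    intro u
    simp only [expTransform_apply]
    refine tendsto_integral_of_dominated_convergence (fun v => c' * ‖h v‖)
      (fun k => (integrable_phase_smul u _).aestronglyMeasurable)
      ((h.integrable (μ := volume)).norm.const_mul c') (fun k => .of_forall fun v => ?_)
      (.of_forall fun v => ?_)
    · rw [hsm, norm_smul, norm_phase, one_mul, norm_smul]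
      gcongr
      exact hc' k v
    · simp only [hsm]
      simpa using ((hψ'.tendsto_one v).smul_const (h v)).const_smul (phase u v)
  refine tendsto_integral_filter_of_dominated_convergence
    (fun u => c * (SchwartzMap.seminorm ℝ 0 0 f *
      ((2 ^ n * (C₀ + C₁)) * (1 + ‖u‖) ^ (-((n : ℝ) + 1)))))
    (.of_forall fun p => ?_) (.of_forall fun p => .of_forall fun u => ?_) ?_
    (.of_forall fun u => ?_)
  · have h1 := (hψ.smooth p.1).continuous
    have h2 := f.continuous
    have h3 := (expTransform (SchwartzMap.smulLeftCLM A (ψ' p.2) h)).continuous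
    exact Continuous.aestronglyMeasurable (by fun_prop)
  · rw [norm_smul]
    gcongr
    · exact hc p.1 u
    · refine (norm_mul_le _ _).trans ?_
      gcongr
      · exact f.norm_le_seminorm ℝ _
      · exact hb p.2 u
  · refine Integrable.const_mul (Integrable.const_mul (Integrable.const_mul ?_ _) _) _
    exact integrable_one_add_norm (by simp)
  · have h1 := (hψ.tendsto_one u).comp (Filter.tendsto_fst (f := .atTop) (g := Filter.atTop (α := ℕ)))
    have h2 := (hpt u).comp (Filter.tendsto_snd (f := Filter.atTop (α := ℕ)) (g := .atTop))
    rw [Filter.prod_atTop_atTop_eq] at h1 h2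
    simpa using h1.smul (h2.const_mul (f (x + L u)))

/-- The deformed product of Schwartz functions is given by the oscillatory integral
`(2π)^{-n} ∫∫ f(x + J u) g(x + v) e^{i u·v} du dv`. -/
theorem isOscillatoryIntegral_deformedMul (J : Matrix (Fin n) (Fin n) ℝ) (f g : 𝓢(V n, A))
    (x : V n) : ∃ a : A, IsOscillatoryIntegral (fun u v =>
      phase u v • (f (x + Matrix.toEuclideanCLM (𝕜 := ℝ) J u) * g (x + v))) a ∧
      deformedMul J f g x = ((2 * Real.pi) ^ n)⁻¹ • a :=
  ⟨_, isOscillatoryIntegral_iterated _ f g x, rfl⟩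

end Schwartz

section Hilbert

variable (n : ℕ) (A : Type*) [NonUnitalCStarAlgebra A]

/-- The space of Schwartz functions `ℝⁿ → A`, as a type of its own, to carry the topology of the norm
`‖·‖₂` below instead of the Fréchet topology. -/
def PreModule : Type _ := 𝓢(V n, A)

noncomputable instance : AddCommGroup (PreModule n A) := inferInstanceAs (AddCommGroup 𝓢(V n, A))
noncomputable instance : Module ℂ (PreModule n A) := inferInstanceAs (Module ℂ 𝓢(V n, A))

/-- The identity map between the two copies of the space of Schwartz functions. -/
noncomputable def toPre : 𝓢(V n, A) ≃ₗ[ℂ] PreModule n A := LinearEquiv.refl ℂ _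

variable {n A}

/-- `⟨f, g⟩ = ∫ f(x)* g(x) dx`. -/
noncomputable instance : Inner A (PreModule n A) where
  inner f g := ∫ x, star ((toPre n A).symm f x) * (toPre n A).symm g x

/-- `‖f‖₂ = ‖⟨f, f⟩‖^{1/2}`. -/
noncomputable instance : Norm (PreModule n A) where
  norm f := √‖inner A f f‖

theorem seminormedCore : SeminormedSpace.Core ℂ (PreModule n A) where
  norm_nonneg f := norm₂_nonneg ((toPre n A).symm f)
  norm_smul c f := norm₂_smul c ((toPre n A).symm f)
  norm_triangle f g := norm₂_add_le ((toPre n A).symm f) ((toPre n A).symm g)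

noncomputable instance : SeminormedAddCommGroup (PreModule n A) :=
  SeminormedAddCommGroup.ofCore seminormedCore

noncomputable instance : NormedSpace ℂ (PreModule n A) where
  norm_smul_le c f := (seminormedCore.norm_smul c f).le

variable (n A) in
/-- The completion of the space of Schwartz functions in the norm `‖·‖₂`. Its `A`-valued inner product
`inner A F G` is the continuous extension of the one of Schwartz functions, see `inner_incl` and
`continuous_inner`. -/
abbrev HilbertModule : Type _ := UniformSpace.Completion (PreModule n A)

variable (n A) in
/-- The canonical map of the Schwartz functions into the completion. -/
noncomputable def incl : 𝓢(V n, A) →ₗ[ℂ] HilbertModule n A :=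
  (UniformSpace.Completion.toComplL (𝕜 := ℂ) (E := PreModule n A)).toLinearMap ∘ₗ
    (toPre n A).toLinearMap


theorem norm_toPre (f : 𝓢(V n, A)) : ‖toPre n A f‖ = norm₂ f := rfl

theorem norm_inner_pre_le (f g : PreModule n A) : ‖inner A f g‖ ≤ ‖f‖ * ‖g‖ :=
  norm_innerInt_le ((toPre n A).symm f) ((toPre n A).symm g)

/-- The inner product of Schwartz functions as a biadditive map. -/
noncomputable def innerAdd : PreModule n A →+ PreModule n A →+ A :=
  AddMonoidHom.mk' (fun f => AddMonoidHom.mk' (fun g => inner A f g)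
    fun _ _ => innerInt_add_right ((toPre n A).symm f) _ _)
    fun f _ => AddMonoidHom.ext fun _ => innerInt_add_left ((toPre n A).symm f) _ _

theorem continuous_inner_pre : Continuous fun p : PreModule n A × PreModule n A =>
    innerAdd p.1 p.2 := by
  refine continuous_iff_continuousAt.2 fun p => ?_
  rw [ContinuousAt, tendsto_iff_norm_sub_tendsto_zero]
  refine squeeze_zero (g := fun q : PreModule n A × PreModule n A =>
    ‖q.1 - p.1‖ * ‖q.2‖ + ‖p.1‖ * ‖q.2 - p.2‖) (fun _ => norm_nonneg _) (fun q => ?_) ?_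
  · have : innerAdd q.1 q.2 - innerAdd p.1 p.2 =
        innerAdd (q.1 - p.1) q.2 + innerAdd p.1 (q.2 - p.2) := by
      simp only [map_sub, AddMonoidHom.sub_apply]
      abel
    rw [this]
    exact (norm_add_le _ _).trans (add_le_add (norm_inner_pre_le _ _) (norm_inner_pre_le _ _))
  · have hc : Continuous fun q : PreModule n A × PreModule n A =>
      ‖q.1 - p.1‖ * ‖q.2‖ + ‖p.1‖ * ‖q.2 - p.2‖ := by fun_prop
    simpa using hc.tendsto p

theorem continuous_inner :
    Continuous fun p : HilbertModule n A × HilbertModule n A => inner A p.1 p.2 := 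
  (UniformSpace.Completion.isDenseInducing_toCompl (PreModule n A)).extend_Z_bilin
    (UniformSpace.Completion.isDenseInducing_toCompl (PreModule n A)) continuous_inner_pre

theorem inner_incl (f g : 𝓢(V n, A)) :
    inner A (incl n A f) (incl n A g) = ∫ x, star (f x) * g x :=
  (UniformSpace.Completion.isDenseInducing_coe.prodMap
    UniformSpace.Completion.isDenseInducing_coe).extend_eq continuous_inner_pre
    (toPre n A f, toPre n A g)

theorem denseRange_incl : DenseRange (incl n A) :=
  (UniformSpace.Completion.denseRange_coe (α := PreModule n A))

theorem norm_incl_sq (f : 𝓢(V n, A)) : ‖incl n A f‖ ^ 2 = ‖∫ x, star (f x) * f x‖ :=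
  (congrArg (· ^ 2) (UniformSpace.Completion.norm_coe (toPre n A f))).trans (norm₂_sq f)

/-- The continuous extension to the completion of an operator on Schwartz functions that is bounded
for `‖·‖₂`. -/
noncomputable def extend (B : 𝓢(V n, A) →ₗ[ℂ] 𝓢(V n, A)) (h : ∃ C, ∀ f, norm₂ (B f) ≤ C * norm₂ f) :
    HilbertModule n A →L[ℂ] HilbertModule n A :=
  ContinuousLinearMap.completion (σ := RingHom.id ℂ) (((toPre n A).conj B).mkContinuousOfExistsBound h)

theorem extend_incl (B : 𝓢(V n, A) →ₗ[ℂ] 𝓢(V n, A)) (h : ∃ C, ∀ f, norm₂ (B f) ≤ C * norm₂ f)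
    (f : 𝓢(V n, A)) : extend B h (incl n A f) = incl n A (B f) :=
  UniformSpace.Completion.map_coe
    (((toPre n A).conj B).mkContinuousOfExistsBound h).uniformContinuous (toPre n A f)

theorem ext_incl {S T : HilbertModule n A →L[ℂ] HilbertModule n A}
    (h : ∀ f, S (incl n A f) = T (incl n A f)) : S = T := by
  refine ContinuousLinearMap.ext fun x => ?_
  exact congrFun (denseRange_incl.equalizer S.continuous T.continuous (funext h)) x

/-- The continuous extension of `T_z f(x) = f(x - z)`. -/
noncomputable def translationCLM (z : V n) : HilbertModule n A →L[ℂ] HilbertModule n A :=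
  extend (SchwartzMap.compSubConstCLM ℂ z).toLinearMap ⟨1, fun f => by
    rw [one_mul]; exact (norm₂_shift z f).le⟩

theorem translationCLM_incl (z : V n) (f : 𝓢(V n, A)) :
    translationCLM z (incl n A f) = incl n A (shift z f) := extend_incl _ _ _

/-- The continuous extension of `M_ζ f(x) = e^{i ζ·x} f(x)`. -/
noncomputable def modulationCLM (ζ : V n) : HilbertModule n A →L[ℂ] HilbertModule n A :=
  extend (SchwartzMap.smulLeftCLM A (fun x => phase ζ x)).toLinearMap ⟨1, fun f => by
    rw [one_mul]; exact (norm₂_modulate ζ f).le⟩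

theorem modulationCLM_incl (ζ : V n) (f : 𝓢(V n, A)) :
    modulationCLM ζ (incl n A f) = incl n A (modulate ζ f) := extend_incl _ _ _

theorem translationCLM_neg_comp (z : V n) :
    (translationCLM (-z)).comp (translationCLM z) =
      ContinuousLinearMap.id ℂ (HilbertModule n A) := by
  refine ext_incl fun f => ?_
  rw [ContinuousLinearMap.comp_apply, translationCLM_incl, translationCLM_incl,
    ContinuousLinearMap.id_apply]
  congr 1
  ext x
  simp [shift_apply]

theorem modulationCLM_neg_comp (ζ : V n) :
    (modulationCLM (-ζ)).comp (modulationCLM ζ) =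
      ContinuousLinearMap.id ℂ (HilbertModule n A) := by
  refine ext_incl fun f => ?_
  rw [ContinuousLinearMap.comp_apply, modulationCLM_incl, modulationCLM_incl,
    ContinuousLinearMap.id_apply]
  congr 1
  ext x
  rw [modulate_apply, modulate_apply, smul_smul, phase_mul_phase_neg, one_smul]

/-- `T_z` as an invertible operator on the completion. -/
noncomputable def translation (z : V n) : HilbertModule n A ≃L[ℂ] HilbertModule n A :=
  ContinuousLinearEquiv.equivOfInverse (translationCLM z) (translationCLM (-z))
    (fun F => DFunLike.congr_fun (translationCLM_neg_comp z) F)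
    (fun F => by simpa using DFunLike.congr_fun (translationCLM_neg_comp (-z)) F)

/-- `M_ζ` as an invertible operator on the completion. -/
noncomputable def modulation (ζ : V n) : HilbertModule n A ≃L[ℂ] HilbertModule n A :=
  ContinuousLinearEquiv.equivOfInverse (modulationCLM ζ) (modulationCLM (-ζ))
    (fun F => DFunLike.congr_fun (modulationCLM_neg_comp ζ) F)
    (fun F => by simpa using DFunLike.congr_fun (modulationCLM_neg_comp (-ζ)) F)

/-- `E_{z,ζ} = M_ζ T_z`. -/
noncomputable def heisenberg (z ζ : V n) : HilbertModule n A ≃L[ℂ] HilbertModule n A :=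
  (translation z).trans (modulation ζ)

/-- `T_{z,ζ} = E_{z,ζ}⁻¹ T E_{z,ζ}`. -/
noncomputable def conjugate (T : HilbertModule n A →L[ℂ] HilbertModule n A) (z ζ : V n) :
    HilbertModule n A →L[ℂ] HilbertModule n A :=
  ((heisenberg (A := A) z ζ).symm : HilbertModule n A →L[ℂ] HilbertModule n A) ∘L T ∘L
    (heisenberg (A := A) z ζ : HilbertModule n A →L[ℂ] HilbertModule n A)

/-- `R_g`: the continuous extension to the completion of `f ↦ f ×_J g`. -/
noncomputable def rightMul (J : Matrix (Fin n) (Fin n) ℝ) (g : 𝓢(V n, A)) :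
    HilbertModule n A →L[ℂ] HilbertModule n A :=
  extend
    { toFun := fun f => deformedMul J f g
      map_add' := fun f f' => by
        ext x
        simp only [add_apply, deformedMul_eq_twist, twist, add_mul, smul_add]
        rw [integral_add (integrable_twist _ _ _ _) (integrable_twist _ _ _ _), smul_add]
      map_smul' := fun c f => by
        ext x
        simp only [smul_apply, deformedMul_eq_twist, twist, smul_mul_assoc, smul_comm _ c,
          integral_smul, RingHom.id_apply] }
    ⟨_, fun f => norm₂_deformedMul_le J f g⟩

theorem rightMul_incl (J : Matrix (Fin n) (Fin n) ℝ) (f g : 𝓢(V n, A)) :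
    rightMul J g (incl n A f) = incl n A (deformedMul J f g) := extend_incl _ _ _

/-- `T` has an adjoint for the `A`-valued inner product. -/
def IsAdjointable (T : HilbertModule n A →L[ℂ] HilbertModule n A) : Prop :=
  ∃ S : HilbertModule n A →L[ℂ] HilbertModule n A, ∀ F G, inner A (T F) G = inner A F (S G)

/-- `z ↦ T_{z,0}` is `C^∞` for the operator norm. -/
def TranslationSmooth (T : HilbertModule n A →L[ℂ] HilbertModule n A) : Prop :=
  ContDiff ℝ ∞ fun z : V n => conjugate T z 0

/-- `(z, ζ) ↦ T_{z,ζ}` is `C^∞` for the operator norm. -/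
def HeisenbergSmooth (T : HilbertModule n A →L[ℂ] HilbertModule n A) : Prop :=
  ContDiff ℝ ∞ fun p : V n × V n => conjugate T p.1 p.2

end Hilbert

end Rieffel

namespace Rieffel

section Commutation

variable {n : ℕ} {A : Type*} [NonUnitalCStarAlgebra A]

open Filter Topology

/-! Integrating out `v` in the deformed product leaves `R_g f (x) = (2π)^{-n} ∫ e^{-iu·x} f(x + Ju)
ĝ(u) du`, where `ĝ` is `expTransform g`. Thus `R_g` is a superposition, over `u`, of the Heisenberg
operators `E_{-Ju,-u}`, each followed by right multiplication by `ĝ(u)`. Everything that commutes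
with all `R_g` should therefore commute with each `E_{Jζ,ζ}`; the work is to extract a single one
from the superposition.

Two strong limits do this. Since `expTransform` is onto, `ĝ` may be a bump of mass `(2π)^n` at `-ζ`
times an element `a` of `A`. As the bump shrinks, `R_g` tends on Schwartz functions to `E_{Jζ,ζ}`
followed by right multiplication by `a` (`exists_tendsto_rightMul`), and the operators stay bounded
because `R_g` is controlled by the `L¹` norm of `ĝ`. Then `a` runs through an approximate unit,
which replaces the missing unit of `A` (`tendsto_mulConst`). Commutation survives both limits by
`comp_eq_comp_of_tendsto`.

Finally `E_{z,ζ} = E_{Jζ,ζ} E_{z-Jζ,0}`, with no scalar factor. In `E_{z,ζ}⁻¹ T E_{z,ζ}` the factor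
`E_{Jζ,ζ}` passes through `T` and cancels, which leaves `T_{z-Jζ,0}`. Smoothness in `(z,ζ)` is then
smoothness in one variable composed with the linear map `(z,ζ) ↦ z - Jζ`. -/

/-! ### Inverting the transform; norm bounds for extensions -/

/-- The transform is the Fourier transform followed by the dilation by `-(2π)⁻¹`, and both are
bijective on Schwartz functions. Hence the density `ĝ` of `R_g` can be prescribed freely. -/
theorem expTransform_surjective : Function.Surjective (expTransform : 𝓢(V n, A) → 𝓢(V n, A)) := by
  intro G
  let e : V n ≃L[ℝ] V n := ContinuousLinearEquiv.smulLeft (R₁ := ℝ) (M₁ := V n)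
    (Units.mk0 (-(2 * Real.pi)⁻¹) (neg_ne_zero.2 (inv_ne_zero Real.two_pi_pos.ne')) : ℝˣ)
  refine ⟨FourierTransformInv.fourierInv
    (SchwartzMap.compCLMOfContinuousLinearEquiv ℂ e.symm G), ?_⟩
  rw [expTransform, FourierTransform.fourier_fourierInv_eq]
  ext u
  exact congrArg G (e.symm_apply_apply u)

theorem norm_incl (f : 𝓢(V n, A)) : ‖incl n A f‖ = norm₂ f :=
  UniformSpace.Completion.norm_coe (toPre n A f)

/-- Retains the explicit constant, which `extend` forgets: the limits below need bounds uniform over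
a family of operators. It follows from density of the Schwartz functions. -/
theorem norm_extend_le (B : 𝓢(V n, A) →ₗ[ℂ] 𝓢(V n, A)) (h : ∃ C, ∀ f, norm₂ (B f) ≤ C * norm₂ f)
    {C : ℝ} (hC : ∀ f, norm₂ (B f) ≤ C * norm₂ f) (F : HilbertModule n A) :
    ‖extend B h F‖ ≤ C * ‖F‖ := by
  refine denseRange_incl.induction_on F
    (isClosed_le (extend B h).continuous.norm (continuous_norm.const_mul C)) fun f => ?_
  rw [extend_incl, norm_incl, norm_incl]
  exact hC f

/-! ### Strong limits, dominated convergence and approximate identities -/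

/-- An operator commutes with the strong limit of a bounded family of operators that it commutes
with; the convergence need only hold on the Schwartz functions. -/
theorem comp_eq_comp_of_tendsto {ι : Type*} {l : Filter ι} [l.NeBot]
    {B : ι → HilbertModule n A →L[ℂ] HilbertModule n A}
    {S T : HilbertModule n A →L[ℂ] HilbertModule n A} {C : ℝ}
    (hB : ∀ᶠ i in l, ∀ F, ‖B i F‖ ≤ C * ‖F‖)
    (hlim : ∀ f, Tendsto (fun i => B i (incl n A f)) l (𝓝 (S (incl n A f))))
    (hT : ∀ i, T ∘L B i = B i ∘L T) : T ∘L S = S ∘L T := by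
  have hstrong : ∀ F, Tendsto (fun i => B i F) l (𝓝 (S F)) := by
    intro F
    rw [Metric.tendsto_nhds]
    intro ε hε
    -- Replacing `F` by a nearby `f` costs at most `(|C| + ‖S‖) ‖F - f‖` in total; the summand `1`
    -- only keeps `K` positive.
    set K := |C| + ‖S‖ + 1 with hK
    have hK0 : 0 < K := by positivity
    obtain ⟨f, hf⟩ := denseRange_incl.exists_dist_lt F (ε := ε / (2 * K)) (by positivity)
    filter_upwards [hB, (Metric.tendsto_nhds.1 (hlim f)) (ε / 2) (by positivity)] with i h1 h2
    rw [dist_eq_norm] at *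
    have h3 : B i F - S F = B i (F - incl n A f) + (B i (incl n A f) - S (incl n A f)) -
        S (F - incl n A f) := by
      rw [map_sub, map_sub]; abel
    have h4 := (h1 (F - incl n A f)).trans
      (mul_le_mul_of_nonneg_right (le_abs_self C) (norm_nonneg _))
    have h5 := S.le_opNorm (F - incl n A f)
    have h6 : K * ‖F - incl n A f‖ < ε / 2 := by
      calc _ < K * (ε / (2 * K)) := by gcongr
        _ = ε / 2 := by field_simp
    have h7 := norm_nonneg (F - incl n A f)
    calc _ ≤ ‖B i (F - incl n A f)‖ + ‖B i (incl n A f) - S (incl n A f)‖ +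
          ‖S (F - incl n A f)‖ := by
          rw [h3]; exact (norm_sub_le _ _).trans (by gcongr; exact norm_add_le _ _)
      _ < ε := by rw [hK] at h6; linarith
  refine ext_incl fun f => ?_
  -- The same family has two limits. The second one is taken at `T (incl n A f)`, which need not be
  -- a Schwartz function; this is why convergence was first extended to the whole completion.
  refine tendsto_nhds_unique ((T.continuous.tendsto _).comp (hstrong (incl n A f))) ?_
  refine (hstrong (T (incl n A f))).congr fun i => ?_
  exact (DFunLike.congr_fun (hT i) (incl n A f)).symm

/-- Dominated convergence in the norm `‖·‖₂`. -/
theorem tendsto_incl_of_dominated {k : ℕ → 𝓢(V n, A)} {k' : 𝓢(V n, A)} {b : V n → ℝ}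
    (hb : Integrable b) (hk : ∀ᶠ j in atTop, ∀ x, ‖k j x - k' x‖ ^ 2 ≤ b x)
    (hlim : ∀ x, Tendsto (fun j => k j x) atTop (𝓝 (k' x))) :
    Tendsto (fun j => incl n A (k j)) atTop (𝓝 (incl n A k')) := by
  rw [tendsto_iff_norm_sub_tendsto_zero]
  simp_rw [← map_sub, norm_incl]
  -- The limit `0` is written as an integral to match the form of the dominated convergence theorem.
  have h1 : Tendsto (fun j => innerInt (k j - k') (k j - k')) atTop (𝓝 (∫ _ : V n, (0 : A))) := by
    refine tendsto_integral_filter_of_dominated_convergence b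
      (.of_forall fun j => (integrable_star_mul _ _).aestronglyMeasurable) ?_ hb
      (.of_forall fun x => ?_)
    · filter_upwards [hk] with j hj
      refine .of_forall fun x => ?_
      rw [CStarRing.norm_star_mul_self, ← pow_two]
      exact hj x
    · have h2 : Tendsto (fun j => (k j - k') x) atTop (𝓝 0) := by
        simpa using (hlim x).sub_const (k' x)
      simpa using h2.star.mul h2
  rw [integral_zero] at h1
  simpa [norm₂] using h1.norm.sqrt

/-- Schwartz decay is uniform over bounded translations. This supplies the dominating function when
`f(x + Lu)` is averaged over `u` near a point. -/
theorem exists_translate_decay (f : 𝓢(V n, A)) (N : ℕ) (R : ℝ) :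
    ∃ C, 0 ≤ C ∧ ∀ x y : V n, ‖y‖ ≤ R → ‖f (x + y)‖ ≤ C * (1 + ‖x‖) ^ (-(N : ℝ)) := by
  set M := (2 : ℝ) ^ N * ((Finset.Iic (N, 0)).sup fun m => SchwartzMap.seminorm ℝ m.1 m.2) f
  have hM : ∀ z, (1 + ‖z‖) ^ N * ‖f z‖ ≤ M := fun z => by
    simpa using SchwartzMap.one_add_le_sup_seminorm_apply (𝕜 := ℝ) (m := (N, 0)) le_rfl le_rfl f z
  have hM0 : 0 ≤ M := (by positivity : 0 ≤ (1 + ‖(0 : V n)‖) ^ N * ‖f 0‖).trans (hM 0)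
  refine ⟨(1 + |R|) ^ N * M, by positivity, fun x y hy => ?_⟩
  have h0 : 0 < 1 + ‖x‖ := by positivity
  rw [Real.rpow_neg h0.le, Real.rpow_natCast, ← div_eq_mul_inv, le_div_iff₀ (by positivity),
    mul_comm]
  -- Peetre's inequality, which trades the weight at `x` for the weight at `x + y`.
  have h1 : 1 + ‖x‖ ≤ (1 + |R|) * (1 + ‖x + y‖) := by
    have h2 : ‖x‖ ≤ ‖x + y‖ + ‖y‖ := by simpa using norm_sub_le (x + y) y
    have h3 := hy.trans (le_abs_self R)
    nlinarith [norm_nonneg (x + y), abs_nonneg R]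
  calc _ ≤ ((1 + |R|) * (1 + ‖x + y‖)) ^ N * ‖f (x + y)‖ := by gcongr
    _ = (1 + |R|) ^ N * ((1 + ‖x + y‖) ^ N * ‖f (x + y)‖) := by
        rw [mul_pow, mul_assoc]
    _ ≤ _ := by gcongr; exact hM _

/-- Averages over bump functions shrinking to a point converge to the value at the point. -/
theorem tendsto_integral_normed_smul {u₀ : V n} {φ : ℕ → ContDiffBump u₀}
    (hφ : Tendsto (fun j => (φ j).rOut) atTop (𝓝 0)) {h : V n → A} (hh : Continuous h) :
    Tendsto (fun j => ∫ u, (φ j).normed volume u • h u) atTop (𝓝 (h u₀)) := by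
  refine Metric.tendsto_nhds.2 fun ε hε => ?_
  obtain ⟨δ, hδ, hd⟩ := Metric.continuousAt_iff.1 hh.continuousAt (ε / 2) (half_pos hε)
  filter_upwards [hφ.eventually_lt_const hδ] with j hj
  refine lt_of_le_of_lt ?_ (half_lt_self hε)
  have hi : Integrable fun u => (φ j).normed volume u • h u :=
    ((φ j).continuous_normed.smul hh).integrable_of_hasCompactSupport
      (φ j).hasCompactSupport_normed.smul_right
  -- As the bump has integral one, `h u₀` is itself an average of a constant, and the difference
  -- becomes the average of `h u - h u₀`.
  rw [dist_eq_norm, ← (φ j).integral_normed_smul (μ := volume) (h u₀),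
    ← integral_sub hi ((φ j).integrable_normed.smul_const _)]
  simp_rw [← smul_sub]
  calc _ ≤ ∫ u, (φ j).normed volume u * (ε / 2) := by
        refine norm_integral_le_of_norm_le ((φ j).integrable_normed.mul_const _)
          (.of_forall fun u => ?_)
        rw [norm_smul, Real.norm_of_nonneg ((φ j).nonneg_normed u)]
        by_cases hu : u ∈ Metric.ball u₀ (φ j).rOut
        · have h1 := (φ j).nonneg_normed (μ := volume) u
          have h2 := hd ((Metric.mem_ball.1 hu).trans hj)
          rw [dist_eq_norm] at h2
          gcongr
        · rw [← (φ j).support_normed_eq (μ := volume), Function.notMem_support] at hu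
          simp [hu]
    _ = ε / 2 := by rw [integral_mul_const, (φ j).integral_normed, one_mul]

/-! ### Right multiplication by elements of `A` and approximate units -/

theorem norm₂_mulConst_le (f : 𝓢(V n, A)) (a : A) : norm₂ (mulConst f a) ≤ ‖a‖ * norm₂ f := by
  refine (pow_le_pow_iff_left₀ (norm₂_nonneg _)
    (mul_nonneg (norm_nonneg _) (norm₂_nonneg _)) two_ne_zero).1 ?_
  rw [norm₂_sq, innerInt_mulConst_left, innerInt_mulConst_right, mul_pow, norm₂_sq]
  calc _ ≤ ‖star a‖ * (‖innerInt f f‖ * ‖a‖) :=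
        (norm_mul_le _ _).trans (by gcongr; exact norm_mul_le _ _)
    _ = _ := by rw [norm_star]; ring

/-- The continuous extension of `f ↦ f a`. -/
noncomputable def mulConstCLM (a : A) : HilbertModule n A →L[ℂ] HilbertModule n A :=
  extend (SchwartzMap.postcompCLM ((ContinuousLinearMap.mul ℂ A).flip a)).toLinearMap
    ⟨‖a‖, fun f => norm₂_mulConst_le f a⟩

theorem mulConstCLM_incl (a : A) (f : 𝓢(V n, A)) :
    mulConstCLM a (incl n A f) = incl n A (mulConst f a) := extend_incl _ _ _

theorem norm_mulConstCLM_le (a : A) (F : HilbertModule n A) : ‖mulConstCLM a F‖ ≤ ‖a‖ * ‖F‖ :=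
  norm_extend_le _ _ (fun f => norm₂_mulConst_le f a) F

/-- With `c = ⟨f, f⟩`, the square of `‖f e - f‖₂` is the norm of `e*(ce - c) - (ce - c)`, at most `2
‖ce - c‖` when `‖e‖ ≤ 1`. So the approximate unit is tested on the single element `c`, and no
uniformity in `x` is needed. -/
theorem tendsto_mulConst {l : Filter A} (hl : ∀ b : A, Tendsto (b * ·) l (𝓝 b))
    (hb : ∀ᶠ e in l, ‖e‖ ≤ 1) (f : 𝓢(V n, A)) :
    Tendsto (fun e => incl n A (mulConst f e)) l (𝓝 (incl n A f)) := by
  rw [tendsto_iff_norm_sub_tendsto_zero]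
  simp_rw [← map_sub, norm_incl]
  set c := innerInt f f with hc
  have h1 : ∀ e, innerInt (mulConst f e - f) (mulConst f e - f) =
      star e * (c * e - c) - (c * e - c) := by
    intro e
    have : mulConst f e - f = mulConst f e + (-1 : ℂ) • f := by
      rw [neg_one_smul, sub_eq_add_neg]
    rw [this]
    simp only [innerInt_add_left, innerInt_add_right, innerInt_smul_left, innerInt_smul_right,
      innerInt_mulConst_left, innerInt_mulConst_right, ← hc]
    simp only [star_neg, star_one, neg_smul, one_smul, mul_sub, add_mul, neg_mul, mul_assoc]
    abel
  have h2 : Tendsto (fun e => c * e - c) l (𝓝 0) := by simpa using (hl c).sub_const c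
  have h3 : Tendsto (fun e => innerInt (mulConst f e - f) (mulConst f e - f)) l (𝓝 0) := by
    refine squeeze_zero_norm' (a := fun e => 2 * ‖c * e - c‖) ?_ (by simpa using h2.norm.const_mul 2)
    filter_upwards [hb] with e he
    rw [h1]
    calc _ ≤ ‖star e‖ * ‖c * e - c‖ + ‖c * e - c‖ :=
          (norm_sub_le _ _).trans (by gcongr; exact norm_mul_le _ _)
      _ ≤ 1 * ‖c * e - c‖ + ‖c * e - c‖ := by rw [norm_star]; gcongr
      _ = _ := by ring
  simpa [norm₂] using h3.norm.sqrt

/-! ### Recovering Heisenberg operators from the operators `R_g` -/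

/-- The bound sees only the `L¹` norm of the transform, which does not grow when a bump of fixed
mass shrinks to a point. -/
theorem norm_rightMul_le (J : Matrix (Fin n) (Fin n) ℝ) (g : 𝓢(V n, A)) (F : HilbertModule n A) :
    ‖rightMul J g F‖ ≤ (((2 * Real.pi) ^ n)⁻¹ * ∫ u, ‖expTransform g u‖) * ‖F‖ :=
  norm_extend_le _ _ (fun f => norm₂_deformedMul_le J f g) F

/-- There are Schwartz functions `g` for which `R_g` approximates
`f ↦ (x ↦ e^{-i u₀·x} f(x + J u₀) a)`. -/
theorem exists_tendsto_rightMul (J : Matrix (Fin n) (Fin n) ℝ) (u₀ : V n) (a : A) :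
    ∃ g : ℕ → 𝓢(V n, A), (∀ j F, ‖rightMul J (g j) F‖ ≤ ‖a‖ * ‖F‖) ∧
      ∀ f, Tendsto (fun j => rightMul J (g j) (incl n A f)) atTop
        (𝓝 (incl n A (mulConst (modulate (-u₀)
          (shift (-Matrix.toEuclideanCLM (𝕜 := ℝ) J u₀) f)) a))) := by
  set L := Matrix.toEuclideanCLM (𝕜 := ℝ) J
  set p : ℝ := (2 * Real.pi) ^ n with hp
  have hp0 : 0 < p := by positivity
  -- The outer radii tend to `0` and never exceed `1`, so all supports lie in one bounded set and a
  -- single dominating function serves every `j`.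
  let φ : ℕ → ContDiffBump u₀ := fun j =>
    ⟨1 / (2 * (j + 1)), 1 / (j + 1), by positivity, by
      rw [div_lt_div_iff_of_pos_left one_pos (by positivity) (by positivity)]
      linarith [(by positivity : (0 : ℝ) < j + 1)]⟩
  have hφ : Tendsto (fun j => (φ j).rOut) atTop (𝓝 0) := tendsto_one_div_add_atTop_nhds_zero_nat
  have hφ1 : ∀ j, (φ j).rOut ≤ 1 := fun j => by
    change 1 / ((j : ℝ) + 1) ≤ 1
    rw [div_le_one (by positivity)]
    linarith [(Nat.cast_nonneg j : (0 : ℝ) ≤ j)]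
  let ψ : ℕ → 𝓢(V n, ℝ) := fun j =>
    (φ j).hasCompactSupport_normed (μ := volume) |>.toSchwartzMap (φ j).contDiff_normed
  -- The prescribed transform of `g j`. The factor `p` cancels the prefactor `(2π)^{-n}` of the
  -- deformed product, which makes the operator bound exactly `‖a‖`.
  let G : ℕ → 𝓢(V n, A) := fun j =>
    (ψ j).postcompCLM ((ContinuousLinearMap.id ℝ ℝ).smulRight (p • a))
  have hG : ∀ j u, G j u = (φ j).normed volume u • p • a := fun j u => rfl
  choose g hg using fun j => expTransform_surjective (G j)
  refine ⟨g, fun j F => (norm_rightMul_le J (g j) F).trans_eq ?_, fun f => ?_⟩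
  · have : ∫ u, ‖expTransform (g j) u‖ = p * ‖a‖ := by
      simp only [hg, hG, norm_smul, Real.norm_of_nonneg ((φ j).nonneg_normed _)]
      rw [integral_mul_const, (φ j).integral_normed, one_mul, Real.norm_of_nonneg hp0.le]
    rw [this, inv_mul_cancel_left₀ hp0.ne']
  simp_rw [rightMul_incl]
  let h : V n → V n → A := fun x u => phase (-u) x • (f (x + L u) * a)
  have hh : ∀ x, Continuous (h x) := fun x => by
    have h1 : Continuous fun u : V n => phase (-u) x :=
      continuous_phase.comp (by fun_prop : Continuous fun u : V n => (-u, x))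
    have h2 := f.continuous
    fun_prop
  have hk : ∀ j x, deformedMul J f (g j) x = ∫ u, (φ j).normed volume u • h x u := by
    intro j x
    rw [deformedMul_eq_twist, hg, twist, ← integral_smul]
    congr 1
    ext u
    rw [hG, mul_smul_comm, mul_smul_comm, smul_comm _ p, smul_comm _ p, inv_smul_smul₀ hp0.ne',
      smul_comm (phase _ _)]
  have hk' : ∀ x, mulConst (modulate (-u₀) (shift (-L u₀) f)) a x = h x u₀ := fun x => by
    rw [mulConst_apply, modulate_apply, shift_apply, sub_neg_eq_add, smul_mul_assoc]
  -- The radius bounds `‖L u‖` for `u` within distance `1` of `u₀`. Decay of order `n + 1` becomes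
  -- order `2(n + 1) > n` after squaring, hence is integrable.
  obtain ⟨C, hC0, hC⟩ := exists_translate_decay f (n + 1) (‖L‖ * (‖u₀‖ + 1))
  have hb : ∀ x u, ‖u - u₀‖ ≤ 1 → ‖h x u‖ ≤ C * (1 + ‖x‖) ^ (-((n + 1 : ℕ) : ℝ)) * ‖a‖ := by
    intro x u hu
    rw [norm_smul, norm_phase, one_mul]
    refine (norm_mul_le _ _).trans ?_
    gcongr
    refine hC x (L u) ((L.le_opNorm u).trans ?_)
    gcongr
    calc ‖u‖ = ‖u₀ + (u - u₀)‖ := by simp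
      _ ≤ _ := (norm_add_le _ _).trans (by gcongr)
  -- The averaged function and its limit obey the same pointwise bound, whence the factor `2` inside
  -- the square.
  refine tendsto_incl_of_dominated
    (b := fun x => (2 * C * ‖a‖) ^ 2 * (1 + ‖x‖) ^ (-(2 * (n + 1) : ℝ)))
    ((integrable_one_add_norm (by simp; linarith)).const_mul _)
    (.of_forall fun j x => ?_) fun x => ?_
  · have h1 : ‖deformedMul J f (g j) x‖ ≤ C * (1 + ‖x‖) ^ (-((n + 1 : ℕ) : ℝ)) * ‖a‖ := by
      rw [hk]
      set D := C * (1 + ‖x‖) ^ (-((n + 1 : ℕ) : ℝ)) * ‖a‖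
      calc _ ≤ ∫ u, (φ j).normed volume u * D := by
            refine norm_integral_le_of_norm_le ((φ j).integrable_normed.mul_const _)
              (.of_forall fun u => ?_)
            rw [norm_smul, Real.norm_of_nonneg ((φ j).nonneg_normed u)]
            by_cases hu : u ∈ Metric.ball u₀ (φ j).rOut
            · have h1 := (φ j).nonneg_normed (μ := volume) u
              have h2 := hb x u
                ((mem_ball_iff_norm.1 hu).le.trans (hφ1 j))
              gcongr
            · rw [← (φ j).support_normed_eq (μ := volume), Function.notMem_support] at hu
              simp [hu]
        _ = D := by rw [integral_mul_const, (φ j).integral_normed, one_mul]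
    have h2 := hb x u₀ (by simp)
    rw [← hk'] at h2
    have h3 : (1 + ‖x‖) ^ (-(2 * (n + 1) : ℝ)) = ((1 + ‖x‖) ^ (-((n + 1 : ℕ) : ℝ))) ^ 2 := by
      rw [← Real.rpow_natCast, ← Real.rpow_mul (by positivity)]
      congr 1
      push_cast
      ring
    rw [h3, ← mul_pow]
    refine pow_le_pow_left₀ (norm_nonneg _) ((norm_sub_le _ _).trans ?_) 2
    linarith
  · simp_rw [hk, hk']
    exact tendsto_integral_normed_smul hφ (hh x)

/-- An operator commuting with all `R_g` commutes with
`f ↦ (x ↦ e^{iζ·x} f(x - Jζ))`, the right multiplication by `x ↦ e^{iζ·x}`. -/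
theorem comp_heisenberg_of_comp_rightMul (J : Matrix (Fin n) (Fin n) ℝ)
    {T : HilbertModule n A →L[ℂ] HilbertModule n A}
    (hT : ∀ g, T ∘L rightMul J g = rightMul J g ∘L T) (ζ : V n) :
    T ∘L (heisenberg (A := A) (Matrix.toEuclideanCLM (𝕜 := ℝ) J ζ) ζ :
        HilbertModule n A →L[ℂ] HilbertModule n A) =
      (heisenberg (A := A) (Matrix.toEuclideanCLM (𝕜 := ℝ) J ζ) ζ :
        HilbertModule n A →L[ℂ] HilbertModule n A) ∘L T := by
  -- The canonical increasing approximate unit is formulated with respect to the order of `A`.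
  let _ : PartialOrder A := CStarAlgebra.spectralOrder A
  have _ : StarOrderedRing A := CStarAlgebra.spectralOrderedRing A
  have hl := CStarAlgebra.increasingApproximateUnit A
  set W := (heisenberg (A := A) (Matrix.toEuclideanCLM (𝕜 := ℝ) J ζ) ζ :
    HilbertModule n A →L[ℂ] HilbertModule n A)
  have hW : ∀ f, W (incl n A f) =
      incl n A (modulate ζ (shift (Matrix.toEuclideanCLM (𝕜 := ℝ) J ζ) f)) := fun f => by
    rw [← modulationCLM_incl, ← translationCLM_incl]; rfl
  -- The product of `W` with right multiplication by `a` is treated as one operator, so `T` is never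
  -- moved past the multiplication alone.
  have hWa : ∀ a : A, T ∘L (mulConstCLM a ∘L W) = (mulConstCLM a ∘L W) ∘L T := by
    intro a
    -- The bumps sit at `-ζ` because the density at `u` multiplies by `e^{-iu·x}` and translates by
    -- `-Ju`.
    obtain ⟨g, hg, hlim⟩ := exists_tendsto_rightMul J (-ζ) a
    refine comp_eq_comp_of_tendsto (l := atTop) (.of_forall hg) (fun f => ?_) fun j => hT (g j)
    rw [ContinuousLinearMap.comp_apply, hW, mulConstCLM_incl]
    simpa using hlim f
  -- The bound `‖W‖` holds only eventually, where `‖a‖ ≤ 1`.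
  refine comp_eq_comp_of_tendsto (l := CStarAlgebra.approximateUnit A) (C := ‖W‖) ?_ (fun f => ?_)
    hWa
  · filter_upwards [hl.eventually_norm] with a ha F
    calc _ ≤ ‖a‖ * ‖W F‖ := norm_mulConstCLM_le a (W F)
      _ ≤ 1 * (‖W‖ * ‖F‖) := by gcongr; exact W.le_opNorm F
      _ = _ := one_mul _
  · simp only [ContinuousLinearMap.comp_apply, hW, mulConstCLM_incl]
    exact tendsto_mulConst hl.tendsto_mul_left hl.eventually_norm _

/-! ### Factoring Heisenberg operators and conjugating -/

theorem translation_add (z w : V n) (F : HilbertModule n A) :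
    translation (z + w) F = translation z (translation w F) := by
  have : translationCLM (z + w) =
      (translationCLM z).comp (translationCLM w : HilbertModule n A →L[ℂ] HilbertModule n A) := by
    refine ext_incl fun f => ?_
    rw [ContinuousLinearMap.comp_apply, translationCLM_incl, translationCLM_incl,
      translationCLM_incl]
    congr 1
    ext x
    simp only [shift_apply]
    congr 1
    abel
  exact DFunLike.congr_fun this F

theorem modulation_zero (F : HilbertModule n A) : modulation 0 F = F := by
  have : modulationCLM 0 = ContinuousLinearMap.id ℂ (HilbertModule n A) := by
    refine ext_incl fun f => ?_
    rw [modulationCLM_incl, ContinuousLinearMap.id_apply]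
    congr 1
    ext x
    simp [modulate_apply, phase]
  exact DFunLike.congr_fun this F

/-- Only the translation is split, as `z = w + (z - w)`. No modulation is moved past a translation,
so no Weyl phase appears. -/
theorem heisenberg_eq (z w ζ : V n) (F : HilbertModule n A) :
    heisenberg z ζ F = heisenberg w ζ (heisenberg (z - w) 0 F) := by
  change modulation ζ (translation z F) =
    modulation ζ (translation w (modulation 0 (translation (z - w) F)))
  rw [modulation_zero, ← translation_add, add_sub_cancel]

/-- By the factorization `E_{z,ζ} = E_{w,ζ} E_{z-w,0}`, the inner factor `E_{w,ζ}` commutes with `T`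
and cancels against its inverse. -/
theorem conjugate_eq_of_comp_heisenberg {T : HilbertModule n A →L[ℂ] HilbertModule n A}
    {w ζ : V n} (hT : T ∘L (heisenberg (A := A) w ζ : HilbertModule n A →L[ℂ] HilbertModule n A) =
      (heisenberg (A := A) w ζ : HilbertModule n A →L[ℂ] HilbertModule n A) ∘L T) (z : V n) :
    conjugate T z ζ = conjugate T (z - w) 0 := by
  ext F
  change (heisenberg z ζ).symm (T (heisenberg z ζ F)) =
    (heisenberg (z - w) 0).symm (T (heisenberg (z - w) 0 F))
  rw [ContinuousLinearEquiv.symm_apply_eq, heisenberg_eq z w ζ F, heisenberg_eq z w ζ,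
    ContinuousLinearEquiv.apply_symm_apply]
  exact DFunLike.congr_fun hT _

end Commutation

end Rieffel

/-- Let `A` be a separable C*-algebra, `J` an antisymmetric real `n × n` matrix, and `T` an adjointable
operator on the completion of the `A`-valued Schwartz functions that commutes with all `R_g`, `g` a
Schwartz function. Then `T_{z,ζ} = T_{z - J ζ, 0}` for all `z` and `ζ`, and if `T` is smooth under
translations, then `T` is Heisenberg-smooth. -/
theorem mainTheorem3 {A : Type*} [NonUnitalCStarAlgebra A] [TopologicalSpace.SeparableSpace A]
    (n : ℕ) (J : Matrix (Fin n) (Fin n) ℝ) (hJ : J.transpose = -J)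
    (T : Rieffel.HilbertModule n A →L[ℂ] Rieffel.HilbertModule n A)
    (hT : Rieffel.IsAdjointable T)
    (hcomm : ∀ g : 𝓢(Rieffel.V n, A),
      T ∘L Rieffel.rightMul J g = Rieffel.rightMul J g ∘L T) :
    (∀ z ζ : Rieffel.V n, Rieffel.conjugate T z ζ =
      Rieffel.conjugate T (z - Matrix.toEuclideanCLM (𝕜 := ℝ) J ζ) 0) ∧
    (Rieffel.TranslationSmooth T → Rieffel.HeisenbergSmooth T) := by
  have key : ∀ z ζ : Rieffel.V n, Rieffel.conjugate T z ζ =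
      Rieffel.conjugate T (z - Matrix.toEuclideanCLM (𝕜 := ℝ) J ζ) 0 := fun z ζ =>
    Rieffel.conjugate_eq_of_comp_heisenberg (Rieffel.comp_heisenberg_of_comp_rightMul J hcomm ζ) z
  refine ⟨key, fun hs => ?_⟩
  rw [Rieffel.HeisenbergSmooth, funext fun p : Rieffel.V n × Rieffel.V n => key p.1 p.2]
  -- The inner map `(z,ζ) ↦ z - Jζ` is linear on a finite-dimensional space, hence smooth.
  exact ContDiff.comp (g := fun z => Rieffel.conjugate T z 0) hs
    (contDiff_fst.sub ((Matrix.toEuclideanCLM (𝕜 := ℝ) J).contDiff.comp contDiff_snd))
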